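/- Let $(H,\Delta)$ be a finite quantum group: $H$ is a finite-dimensional unital C*-algebra and $\Delta\colon H\to H\otimes H$ is an injective unital $*$-homomorphism such that $(\Delta\otimes\mathrm{id})\circ\Delta=(\mathrm{id}\otimes\Delta)\circ\Delta$ and both $\{\Delta(g)(1\otimes h)\mid g,h\in H\}$ and $\{(g\otimes 1)\Delta(h)\mid g,h\in H\}$ have closed linear span $H\otimes H$. Let $$H\circledast^{\Delta}H:=\{f\in C([0,1],H\otimes H)\mid f(0)\in\mathbb{C}\otimes H,\ f(1)\in\Delta(H)\}$$ be the equivariant noncommutative join, with the coaction of $(H,\Delta)$ sending $f$ to $(\mathrm{id}\otimes\Delta)\circ f$, which is regarded as an element of $(H\circledast^{\Delta}H)\otimes H$. If $(H,\Delta)$ is non-trivial, that is, $H\neq\mathbb{C}1$, then there is no unital $*$-homomorphism $\varphi\colon H\to H\circledast^{\Delta}H$ that is $H$-equivariant, that is, such that for all $h\in H$ $$(\varphi\otimes\mathrm{id})(\Delta(h))=(\mathrm{id}\otimes\Delta)\circ\varphi(h)\quad\text{in }(H\circledast^{\Delta}H)\otimes H .$$ -/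

import Mathlib

open scoped TensorProduct

noncomputable section

namespace FiniteQuantum

universe u v

section Topology

variable (A : Type u) (B : Type v) [Ring A] [Algebra ℂ A] [FiniteDimensional ℂ A]
  [Ring B] [Algebra ℂ B] [FiniteDimensional ℂ B]

/-- For finite-dimensional C⋆-algebras the algebraic tensor product is already complete, and the
minimal tensor product is `A ⊗[ℂ] B` itself.  Its C⋆-norm topology, like every Hausdorff vector
space topology on a finite-dimensional space, is the canonical (module) topology;
see `tensorTopology_unique`. -/
instance tensorTopology : TopologicalSpace (A ⊗[ℂ] B) := moduleTopology ℂ (A ⊗[ℂ] B)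

instance tensor_isModuleTopology : IsModuleTopology ℂ (A ⊗[ℂ] B) := ⟨rfl⟩

/-- Any Hausdorff vector space topology on `A ⊗[ℂ] B`, in particular the topology of any norm,
is the topology used here. -/
theorem tensorTopology_unique (τ : TopologicalSpace (A ⊗[ℂ] B))
    (h1 : @T2Space _ τ) (h2 : @IsTopologicalAddGroup _ τ _) (h3 : @ContinuousSMul ℂ _ _ _ τ) :
    τ = tensorTopology A B := by
  have h4 : @IsModuleTopology ℂ _ (A ⊗[ℂ] B) _ _ τ :=
    @isModuleTopologyOfFiniteDimensional ℂ _ (A ⊗[ℂ] B) _ _ τ h2 h3 _ h1 _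
  exact @eq_moduleTopology ℂ _ (A ⊗[ℂ] B) _ _ τ h4

instance tensor_isTopologicalRing : IsTopologicalRing (A ⊗[ℂ] B) :=
  IsModuleTopology.isTopologicalRing ℂ (A ⊗[ℂ] B)

instance tensor_continuousStar [StarRing A] [StarModule ℂ A] [StarRing B] [StarModule ℂ B] :
    ContinuousStar (A ⊗[ℂ] B) where
  continuous_star :=
    IsModuleTopology.continuous_of_linearMapₛₗ (σ := starRingEnd ℂ) Complex.continuous_conj
      (starLinearEquiv ℂ (A := A ⊗[ℂ] B)).toLinearMap

end Topology

/-- A finite quantum group: a compact quantum group structure on the finite-dimensional unital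
C⋆-algebra `H`, i.e. an injective coassociative unital ⋆-homomorphism `Δ : H → H ⊗ H` satisfying
the two cancellation laws. -/
structure QuantumGroup (H : Type u) [CStarAlgebra H] [FiniteDimensional ℂ H] where
  /-- the coproduct -/
  Δ : H →⋆ₐ[ℂ] H ⊗[ℂ] H
  injective : Function.Injective Δ
  /-- `(Δ ⊗ id) ∘ Δ = (id ⊗ Δ) ∘ Δ` -/
  coassoc : ∀ h : H,
    TensorProduct.assoc ℂ H H H (LinearMap.rTensor H Δ.toAlgHom.toLinearMap (Δ h)) =
      LinearMap.lTensor H Δ.toAlgHom.toLinearMap (Δ h)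
  cancel_right :
    (Submodule.span ℂ {x : H ⊗[ℂ] H | ∃ g h : H, x = Δ g * (1 ⊗ₜ[ℂ] h)}).topologicalClosure = ⊤
  cancel_left :
    (Submodule.span ℂ {x : H ⊗[ℂ] H | ∃ g h : H, x = (g ⊗ₜ[ℂ] 1) * Δ h}).topologicalClosure = ⊤

/-- An action of a finite quantum group on a finite-dimensional unital C⋆-algebra `A`, given by
the coaction `δ : A → A ⊗ H`. -/
structure QuantumAction {H : Type u} [CStarAlgebra H] [FiniteDimensional ℂ H]
    (Q : QuantumGroup H) (A : Type v) [CStarAlgebra A] [FiniteDimensional ℂ A] where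
  /-- the coaction -/
  δ : A →⋆ₐ[ℂ] A ⊗[ℂ] H
  injective : Function.Injective δ
  /-- `(δ ⊗ id) ∘ δ = (id ⊗ Δ) ∘ δ` -/
  coassoc : ∀ a : A,
    TensorProduct.assoc ℂ A H H (LinearMap.rTensor H δ.toAlgHom.toLinearMap (δ a)) =
      LinearMap.lTensor A Q.Δ.toAlgHom.toLinearMap (δ a)
  counital :
    (Submodule.span ℂ {x : A ⊗[ℂ] H | ∃ (a : A) (h : H), x = δ a * (1 ⊗ₜ[ℂ] h)}).topologicalClosure
      = ⊤

/-- A quantum group acting on its own algebra by its coproduct: `(A, δ) = (H, Δ)`. -/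
def QuantumGroup.selfAction {H : Type u} [CStarAlgebra H] [FiniteDimensional ℂ H]
    (Q : QuantumGroup H) : QuantumAction Q H where
  δ := Q.Δ
  injective := Q.injective
  coassoc := Q.coassoc
  counital := Q.cancel_right

section Join

variable {H : Type u} [CStarAlgebra H] [FiniteDimensional ℂ H] {Q : QuantumGroup H}
  {A : Type v} [CStarAlgebra A] [FiniteDimensional ℂ A]

/-- The equivariant noncommutative join of `A` and `H`:
`{f ∈ C([0,1], A ⊗ H) | f(0) ∈ ℂ ⊗ H, f(1) ∈ δ(A)}`, with pointwise operations. -/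
def equivariantJoin (α : QuantumAction Q A) : StarSubalgebra ℂ C(unitInterval, A ⊗[ℂ] H) where
  carrier := {f | (∃ h : H, f 0 = 1 ⊗ₜ[ℂ] h) ∧ ∃ a : A, f 1 = α.δ a}
  mul_mem' := by
    rintro f g ⟨⟨h, hf⟩, a, ha⟩ ⟨⟨k, hg⟩, b, hb⟩
    exact ⟨⟨h * k, by simp [hf, hg]⟩, a * b, by simp [ha, hb]⟩
  add_mem' := by
    rintro f g ⟨⟨h, hf⟩, a, ha⟩ ⟨⟨k, hg⟩, b, hb⟩
    exact ⟨⟨h + k, by simp [hf, hg, TensorProduct.tmul_add]⟩, a + b, by simp [ha, hb]⟩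
  algebraMap_mem' := fun c =>
    ⟨⟨algebraMap ℂ H c, by
        simp [Algebra.algebraMap_eq_smul_one, Algebra.TensorProduct.one_def]⟩,
      algebraMap ℂ A c, by
        simp [Algebra.algebraMap_eq_smul_one, map_smul]⟩
  star_mem' := by
    rintro f ⟨⟨h, hf⟩, a, ha⟩
    exact ⟨⟨star h, by simp [hf]⟩, star a, by simp [ha, map_star]⟩

/-- `(id ⊗ ω) ∘ Δ : H → H` for a linear functional `ω` on `H`. -/
def QuantumGroup.slice (Q : QuantumGroup H) (ω : H →ₗ[ℂ] ℂ) : H →ₗ[ℂ] H :=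
  (TensorProduct.rid ℂ H).toLinearMap ∘ₗ LinearMap.lTensor H ω ∘ₗ Q.Δ.toAlgHom.toLinearMap

/-- `id ⊗ ((id ⊗ ω) ∘ Δ)` maps `δ(A)` to itself. -/
theorem QuantumAction.lTensor_slice (α : QuantumAction Q A) (ω : H →ₗ[ℂ] ℂ) (a : A) :
    LinearMap.lTensor A (Q.slice ω) (α.δ a) =
      α.δ (TensorProduct.rid ℂ A (LinearMap.lTensor A ω (α.δ a))) := by
  have key : ∀ y : A ⊗[ℂ] H,
      LinearMap.lTensor A ((TensorProduct.rid ℂ H).toLinearMap ∘ₗ LinearMap.lTensor H ω)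
        (TensorProduct.assoc ℂ A H H (LinearMap.rTensor H α.δ.toAlgHom.toLinearMap y)) =
      α.δ (TensorProduct.rid ℂ A (LinearMap.lTensor A ω y)) := by
    intro y
    induction y with
    | zero => simp
    | add x y hx hy => simp only [map_add, hx, hy]
    | tmul b h =>
      have : ∀ z : A ⊗[ℂ] H,
          LinearMap.lTensor A ((TensorProduct.rid ℂ H).toLinearMap ∘ₗ LinearMap.lTensor H ω)
            (TensorProduct.assoc ℂ A H H (z ⊗ₜ[ℂ] h)) = ω h • z := by
        intro z
        induction z with
        | zero => simp
        | add x y hx hy => simp only [TensorProduct.add_tmul, map_add, hx, hy, smul_add]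
        | tmul c k => simp
      simpa using this (α.δ b)
  rw [← key, α.coassoc, ← LinearMap.comp_apply, ← LinearMap.lTensor_comp]
  rfl

/-- The linear map `f ↦ (id ⊗ id ⊗ ω) ∘ (id ⊗ Δ) ∘ f` on the equivariant join. -/
def joinSlice (α : QuantumAction Q A) (ω : H →ₗ[ℂ] ℂ) :
    equivariantJoin α →ₗ[ℂ] equivariantJoin α where
  toFun f :=
    ⟨⟨fun t => LinearMap.lTensor A (Q.slice ω) (f.1 t),
        (IsModuleTopology.continuous_of_linearMap _).comp f.1.continuous⟩, by
      obtain ⟨⟨h, hh⟩, a, ha⟩ := f.2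
      refine ⟨⟨Q.slice ω h, ?_⟩, TensorProduct.rid ℂ A (LinearMap.lTensor A ω (α.δ a)), ?_⟩
      · change LinearMap.lTensor A (Q.slice ω) (f.1 0) = _
        rw [hh, LinearMap.lTensor_tmul]
      · change LinearMap.lTensor A (Q.slice ω) (f.1 1) = _
        rw [ha, α.lTensor_slice]⟩
  map_add' f g := by ext t; exact map_add (LinearMap.lTensor A (Q.slice ω)) (f.1 t) (g.1 t)
  map_smul' c f := by ext t; exact map_smul (LinearMap.lTensor A (Q.slice ω)) c (f.1 t)

/-- The coaction `f ↦ (id ⊗ Δ) ∘ f` of `H` on the equivariant join, with values in `join ⊗ H`.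
The identification of a function `[0,1] → (A ⊗ H) ⊗ H` with an element of `join ⊗ H` is made by
expanding the last leg in a basis of `H`; `eval_joinCoaction` and `eval_injective` together say
that the result is the unique element of `join ⊗ H` representing the function `(id ⊗ Δ) ∘ f`. -/
def joinCoaction (α : QuantumAction Q A) :
    equivariantJoin α →ₗ[ℂ] equivariantJoin α ⊗[ℂ] H :=
  ∑ i, (TensorProduct.mk ℂ (equivariantJoin α) H).flip (Module.finBasis ℂ H i) ∘ₗ
    joinSlice α ((Module.finBasis ℂ H).coord i)

/-- Evaluation at `t ∈ [0,1]` on the equivariant join. -/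
def joinEval (α : QuantumAction Q A) (t : unitInterval) : equivariantJoin α →ₗ[ℂ] A ⊗[ℂ] H where
  toFun f := f.1 t
  map_add' _ _ := rfl
  map_smul' _ _ := rfl

theorem eval_joinCoaction (α : QuantumAction Q A) (f : equivariantJoin α) (t : unitInterval) :
    TensorProduct.assoc ℂ A H H (LinearMap.rTensor H (joinEval α t) (joinCoaction α f)) =
      LinearMap.lTensor A Q.Δ.toAlgHom.toLinearMap (f.1 t) := by
  have h1 : ∀ y : H ⊗[ℂ] H, ∑ i, (TensorProduct.rid ℂ H
      (LinearMap.lTensor H ((Module.finBasis ℂ H).coord i) y)) ⊗ₜ[ℂ] (Module.finBasis ℂ H i) = y := by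
    intro y
    induction y with
    | zero => simp
    | add x y hx hy =>
      simp only [map_add, TensorProduct.add_tmul, Finset.sum_add_distrib, hx, hy]
    | tmul a b =>
      simp only [LinearMap.lTensor_tmul, TensorProduct.rid_tmul, TensorProduct.smul_tmul]
      rw [← TensorProduct.tmul_sum]
      congr 1
      exact (Module.finBasis ℂ H).sum_repr b
  have h2 : ∀ x : A ⊗[ℂ] H, TensorProduct.assoc ℂ A H H
      (∑ i, (LinearMap.lTensor A (Q.slice ((Module.finBasis ℂ H).coord i)) x) ⊗ₜ[ℂ]
        (Module.finBasis ℂ H i)) = LinearMap.lTensor A Q.Δ.toAlgHom.toLinearMap x := by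
    intro x
    induction x with
    | zero => simp
    | add x y hx hy =>
      simp only [map_add, TensorProduct.add_tmul, Finset.sum_add_distrib, hx, hy]
    | tmul a h =>
      simp only [LinearMap.lTensor_tmul, map_sum, TensorProduct.assoc_tmul]
      rw [← TensorProduct.tmul_sum]
      congr 1
      exact h1 (Q.Δ h)
  rw [← h2 (f.1 t)]
  simp only [joinCoaction, LinearMap.sum_apply, map_sum]
  rfl

theorem eval_injective (α : QuantumAction Q A) (z w : equivariantJoin α ⊗[ℂ] H)
    (h : ∀ t, LinearMap.rTensor H (joinEval α t) z = LinearMap.rTensor H (joinEval α t) w) :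
    z = w := by
  have key : ∀ (t : unitInterval) (i) (z : equivariantJoin α ⊗[ℂ] H),
      TensorProduct.equivFinsuppOfBasisRight (Module.finBasis ℂ H)
        (LinearMap.rTensor H (joinEval α t) z) i =
      joinEval α t (TensorProduct.equivFinsuppOfBasisRight (Module.finBasis ℂ H) z i) := by
    intro t i z
    induction z with
    | zero => simp
    | add x y hx hy => simp only [map_add, Finsupp.add_apply, hx, hy]
    | tmul a b => simp
  apply (TensorProduct.equivFinsuppOfBasisRight (Module.finBasis ℂ H)).injective
  ext i t
  have := key t i z
  rw [h t, key t i w] at this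
  exact this.symm

/-- `H`-equivariance of a unital ⋆-homomorphism `φ` from `A` to the equivariant join of `A` and
`H`: `(φ ⊗ id) ∘ δ` is the coaction of the join composed with `φ`. -/
def IsEquivariant (α : QuantumAction Q A) (φ : A →⋆ₐ[ℂ] equivariantJoin α) : Prop :=
  ∀ a : A, LinearMap.rTensor H φ.toAlgHom.toLinearMap (α.δ a) = joinCoaction α (φ a)

end Join

end FiniteQuantum

end

open scoped TensorProduct

noncomputable section

namespace FiniteQuantum

-- Suppose `φ` is equivariant. Composing `φ` with evaluation at `t` and then with `id ⊗ ε`, for `ε`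
-- the counit, gives a continuous path of unital algebra endomorphisms `τ t` of `H` (`slicedEval`).
-- The boundary conditions of the join make `τ 0` scalar-valued and, together with equivariance,
-- make `τ 1` right colinear. A colinear endomorphism is injective (`injective_of_colinear`).
--
-- Idempotents obstruct such a path. If `q` is idempotent, the trace of left multiplication by `τ t
-- q` is the rank of an idempotent, so it is constant in `t` (`trace_constant_of_idempotents`). If
-- `τ 0 q = 0`, then `τ 1 q = 0`, and hence `q = 0`. For a non-trivial idempotent `p`, which exists
-- because `H ≠ ℂ`, the scalar `τ 0 p` is 0 or 1, so `q = p` or `q = 1 - p` gives a contradiction.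
--
-- The counit is not part of the definition; it is built from the cancellation laws.

universe w

/-! ### Idempotents, traces and density in finite dimension. -/

/-- In a finite-dimensional C⋆-algebra other than `ℂ` there is a non-trivial idempotent. -/
theorem exists_nontrivial_idempotent {H : Type w} [CStarAlgebra H] [FiniteDimensional ℂ H]
    (hH : ¬ Function.Surjective (algebraMap ℂ H)) :
    ∃ p : H, IsIdempotentElem p ∧ p ≠ 0 ∧ p ≠ 1 := by
  -- If all self-adjoint elements were scalar, real and imaginary parts would make every element
  -- scalar.
  obtain ⟨a, ha, hna⟩ : ∃ a : H, IsSelfAdjoint a ∧ ∀ c : ℂ, algebraMap ℂ H c ≠ a := by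
    by_contra! hcon
    refine hH fun x => ?_
    obtain ⟨c, hc⟩ := hcon _ (realPart x).2
    obtain ⟨d, hd⟩ := hcon _ (imaginaryPart x).2
    refine ⟨c + Complex.I * d, ?_⟩
    conv_rhs => rw [← realPart_add_I_smul_imaginaryPart x, ← hc, ← hd]
    simp [Algebra.smul_def]
  have hnt : Nontrivial H := by
    by_contra hc
    rw [not_nontrivial_iff_subsingleton] at hc
    exact hna 0 (Subsingleton.elim _ _)
  have hfin : (spectrum ℂ a).Finite := by
    have hint : IsIntegral ℂ a := Algebra.IsIntegral.isIntegral a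
    refine ((minpoly ℂ a).roots.toFinset.finite_toSet).subset fun x hx => ?_
    have h0 := spectrum.subset_polynomial_aeval a (minpoly ℂ a) ⟨x, hx, rfl⟩
    rw [minpoly.aeval, spectrum.zero_eq] at h0
    simpa [minpoly.ne_zero hint] using h0
  have hnorm : IsStarNormal a := ha.isStarNormal
  obtain ⟨r, hr⟩ := spectrum.nonempty_of_isAlgClosed_of_finiteDimensional ℂ a
  obtain ⟨s, hs, hsr⟩ : ∃ s ∈ spectrum ℂ a, s ≠ r := by
    by_contra! hcon
    exact hna r (CFC.eq_algebraMap_of_spectrum_subset_singleton a r hcon).symm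
  classical
  -- The idempotent is the spectral projection of `a` at `r`. It is non-zero because `r` is in the
  -- spectrum, and not 1 because `s` is too.
  let f : ℂ → ℂ := fun x => if x = r then 1 else 0
  have hf : ContinuousOn f (spectrum ℂ a) := hfin.continuousOn f
  refine ⟨cfc f a, ?_, fun h => ?_, fun h => ?_⟩
  · rw [IsIdempotentElem, ← cfc_mul f f a hf hf]
    exact cfc_congr fun x _ => by simp [f]
  · rw [← cfc_zero ℂ a] at h
    simpa [f] using eqOn_of_cfc_eq_cfc h hf continuousOn_const hnorm hr
  · rw [← cfc_one ℂ a] at h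
    simpa [f, hsr] using eqOn_of_cfc_eq_cfc h hf continuousOn_const hnorm hs

/-- The trace is constant along a path of idempotents. -/
theorem trace_constant_of_idempotents {V X : Type*} [AddCommGroup V] [Module ℂ V]
    [FiniteDimensional ℂ V] [TopologicalSpace X] [PreconnectedSpace X] (e : X → Module.End ℂ V)
    (he : ∀ t, IsIdempotentElem (e t)) (hc : Continuous fun t => LinearMap.trace ℂ V (e t))
    (s t : X) : LinearMap.trace ℂ V (e s) = LinearMap.trace ℂ V (e t) := by
  -- The trace of an idempotent is its rank, and a countable subset of ℂ is totally disconnected.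
  have hcount : (Set.range fun t => LinearMap.trace ℂ V (e t)).Countable := by
    refine (Set.countable_range ((↑) : ℕ → ℂ)).mono ?_
    rintro _ ⟨t, rfl⟩
    exact ⟨_, (LinearMap.IsIdempotentElem.isProj_range (e t) (he t)).trace.symm⟩
  exact hcount.isTotallyDisconnected _ subset_rfl (isPreconnected_range hc) ⟨s, rfl⟩ ⟨t, rfl⟩

/-- A subspace that is dense in the canonical topology is everything. -/
theorem eq_top_of_topologicalClosure_eq_top {V : Type*} [AddCommGroup V] [Module ℂ V]
    [TopologicalSpace V] [IsModuleTopology ℂ V] [IsTopologicalAddGroup V] [ContinuousSMul ℂ V]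
    {S : Submodule ℂ V} (hS : S.topologicalClosure = ⊤) : S = ⊤ := by
  by_contra hne
  obtain ⟨f, hf0, hf⟩ := Submodule.exists_le_ker_of_lt_top S (lt_top_iff_ne_top.2 hne)
  have hcl : IsClosed (LinearMap.ker f : Set V) :=
    isClosed_singleton.preimage (IsModuleTopology.continuous_of_linearMap f)
  have h := S.topologicalClosure_minimal hf hcl
  rw [hS, top_le_iff, LinearMap.ker_eq_top] at h
  exact hf0 h

/-! ### The counit, and injectivity of colinear endomorphisms. -/

namespace QuantumGroup

variable {H : Type w} [CStarAlgebra H] [FiniteDimensional ℂ H] (Q : QuantumGroup H)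

theorem span_right :
    Submodule.span ℂ {x : H ⊗[ℂ] H | ∃ g h : H, x = Q.Δ g * (1 ⊗ₜ[ℂ] h)} = ⊤ :=
  eq_top_of_topologicalClosure_eq_top Q.cancel_right

theorem span_left :
    Submodule.span ℂ {x : H ⊗[ℂ] H | ∃ g h : H, x = (g ⊗ₜ[ℂ] 1) * Q.Δ h} = ⊤ :=
  eq_top_of_topologicalClosure_eq_top Q.cancel_left

/-- Linear maps that agree on all `Δ a * (1 ⊗ b)` are equal. -/
theorem ext_right {V : Type*} [AddCommGroup V] [Module ℂ V] {f g : H ⊗[ℂ] H →ₗ[ℂ] V}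
    (h : ∀ a b, f (Q.Δ a * (1 ⊗ₜ[ℂ] b)) = g (Q.Δ a * (1 ⊗ₜ[ℂ] b))) (x : H ⊗[ℂ] H) : f x = g x := by
  have : f = g := LinearMap.ext_on Q.span_right (by rintro _ ⟨a, b, rfl⟩; exact h a b)
  rw [this]

/-- The linear map `a ⊗ b ↦ Δ a * (1 ⊗ b)`. -/
def galois : H ⊗[ℂ] H →ₗ[ℂ] H ⊗[ℂ] H :=
  LinearMap.mul' ℂ (H ⊗[ℂ] H) ∘ₗ
    TensorProduct.map Q.Δ.toAlgHom.toLinearMap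
      (Algebra.TensorProduct.includeRight : H →ₐ[ℂ] H ⊗[ℂ] H).toLinearMap

theorem galois_tmul (a b : H) : Q.galois (a ⊗ₜ b) = Q.Δ a * (1 ⊗ₜ[ℂ] b) := by
  simp [galois]

/-- Right cancellation gives surjectivity; finite dimension turns it into bijectivity. -/
theorem galois_bijective : Function.Bijective Q.galois := by
  have hs : Function.Surjective Q.galois := by
    rw [← LinearMap.range_eq_top, ← top_le_iff, ← Q.span_right, Submodule.span_le]
    rintro _ ⟨a, b, rfl⟩
    exact ⟨a ⊗ₜ b, Q.galois_tmul a b⟩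
  exact ⟨LinearMap.injective_iff_surjective.2 hs, hs⟩

/-- The linear map `Δ a * (1 ⊗ b) ↦ a * b`, which is `ε ⊗ id` for the counit `ε`. -/
def counitAux : H ⊗[ℂ] H →ₗ[ℂ] H :=
  LinearMap.mul' ℂ H ∘ₗ (LinearEquiv.ofBijective Q.galois Q.galois_bijective).symm.toLinearMap

theorem counitAux_apply (a b : H) : Q.counitAux (Q.Δ a * (1 ⊗ₜ[ℂ] b)) = a * b := by
  have : (LinearEquiv.ofBijective Q.galois Q.galois_bijective).symm (Q.Δ a * (1 ⊗ₜ[ℂ] b)) =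
      a ⊗ₜ b := by
    rw [LinearEquiv.symm_apply_eq]
    exact (Q.galois_tmul a b).symm
  simp [counitAux, this]

theorem counitAux_mul_tmul (x : H ⊗[ℂ] H) (c : H) :
    Q.counitAux (x * (1 ⊗ₜ[ℂ] c)) = Q.counitAux x * c := by
  refine Q.ext_right (f := Q.counitAux ∘ₗ LinearMap.mulRight ℂ (1 ⊗ₜ[ℂ] c))
    (g := LinearMap.mulRight ℂ c ∘ₗ Q.counitAux) (fun a b => ?_) x
  simp [mul_assoc, counitAux_apply]

theorem counitAux_comul_mul (a : H) (x : H ⊗[ℂ] H) :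
    Q.counitAux (Q.Δ a * x) = a * Q.counitAux x := by
  refine Q.ext_right (f := Q.counitAux ∘ₗ LinearMap.mulLeft ℂ (Q.Δ a))
    (g := LinearMap.mulLeft ℂ a ∘ₗ Q.counitAux) (fun b c => ?_) x
  simp only [LinearMap.comp_apply, LinearMap.mulLeft_apply, ← mul_assoc, ← map_mul,
    counitAux_apply]

/-- On `Δ a * (1 ⊗ b)`, coassociativity moves the second coproduct to the right leg, where
`counitAux` undoes it. This is the source of the right counit law. -/
theorem lTensor_counitAux (x : H ⊗[ℂ] H) :
    LinearMap.lTensor H Q.counitAux (TensorProduct.assoc ℂ H H H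
      (LinearMap.rTensor H Q.Δ.toAlgHom.toLinearMap x)) = x := by
  refine Q.ext_right (f := LinearMap.lTensor H Q.counitAux ∘ₗ
    (TensorProduct.assoc ℂ H H H).toLinearMap ∘ₗ LinearMap.rTensor H Q.Δ.toAlgHom.toLinearMap)
    (g := LinearMap.id) (fun a b => ?_) x
  have h1 : ∀ y : H ⊗[ℂ] H, TensorProduct.assoc ℂ H H H
      (LinearMap.rTensor H Q.Δ.toAlgHom.toLinearMap (y * (1 ⊗ₜ[ℂ] b))) =
      TensorProduct.assoc ℂ H H H (LinearMap.rTensor H Q.Δ.toAlgHom.toLinearMap y) *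
        (1 ⊗ₜ[ℂ] (1 ⊗ₜ[ℂ] b)) := by
    intro y
    induction y with
    | zero => simp
    | add y z hy hz => simp only [add_mul, map_add, hy, hz]
    | tmul c d =>
      have h2 : ∀ w : H ⊗[ℂ] H, TensorProduct.assoc ℂ H H H (w ⊗ₜ (d * b)) =
          TensorProduct.assoc ℂ H H H (w ⊗ₜ d) * (1 ⊗ₜ[ℂ] (1 ⊗ₜ[ℂ] b)) := by
        intro w
        induction w with
        | zero => simp
        | add y z hy hz => simp only [TensorProduct.add_tmul, add_mul, map_add, hy, hz]
        | tmul p q => simp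
      simpa using h2 (Q.Δ c)
  have h3 : ∀ y : H ⊗[ℂ] H, LinearMap.lTensor H Q.counitAux
      (LinearMap.lTensor H Q.Δ.toAlgHom.toLinearMap y * (1 ⊗ₜ[ℂ] (1 ⊗ₜ[ℂ] b))) =
      y * (1 ⊗ₜ[ℂ] b) := by
    intro y
    induction y with
    | zero => simp
    | add y z hy hz => simp only [add_mul, map_add, hy, hz]
    | tmul c d => simp [counitAux_apply]
  change LinearMap.lTensor H Q.counitAux (TensorProduct.assoc ℂ H H H
      (LinearMap.rTensor H Q.Δ.toAlgHom.toLinearMap _)) = _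
  rw [h1, Q.coassoc, h3, LinearMap.id_apply]

/-- The map `a ↦ ε(a) 1`. -/
def counitOne : H →ₗ[ℂ] H := Q.counitAux ∘ₗ (TensorProduct.mk ℂ H H).flip 1

theorem counitAux_tmul (a b : H) : Q.counitAux (a ⊗ₜ b) = Q.counitOne a * b := by
  simpa [counitOne] using Q.counitAux_mul_tmul (a ⊗ₜ 1) b

theorem lTensor_counitOne (a : H) : LinearMap.lTensor H Q.counitOne (Q.Δ a) = a ⊗ₜ 1 := by
  have h : ∀ y : H ⊗[ℂ] H, LinearMap.lTensor H Q.counitAux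
      (TensorProduct.assoc ℂ H H H (y ⊗ₜ 1)) = LinearMap.lTensor H Q.counitOne y := by
    intro y
    induction y with
    | zero => simp
    | add y z hy hz => simp only [TensorProduct.add_tmul, map_add, hy, hz]
    | tmul c d => simp [counitOne]
  rw [← h]
  exact Q.lTensor_counitAux (a ⊗ₜ 1)

/-- `id ⊗ counitOne` commutes with left multiplication by `g ⊗ 1` and sends `Δ h` to `h ⊗ 1`; left
cancellation does the rest. Applied to `1 ⊗ a`, this forces `counitOne a` to be scalar. -/
theorem lTensor_counitOne_mem (x : H ⊗[ℂ] H) :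
    ∃ h : H, LinearMap.lTensor H Q.counitOne x = h ⊗ₜ 1 := by
  have hx : x ∈ Submodule.span ℂ {x : H ⊗[ℂ] H | ∃ g h : H, x = (g ⊗ₜ[ℂ] 1) * Q.Δ h} := by
    rw [Q.span_left]; trivial
  have hmul : ∀ (g : H) (y : H ⊗[ℂ] H), LinearMap.lTensor H Q.counitOne ((g ⊗ₜ[ℂ] 1) * y) =
      (g ⊗ₜ[ℂ] 1) * LinearMap.lTensor H Q.counitOne y := by
    intro g y
    induction y with
    | zero => simp
    | add y z hy hz => simp only [mul_add, map_add, hy, hz]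
    | tmul c d => simp
  induction hx using Submodule.span_induction with
  | mem x hx =>
    obtain ⟨g, h, rfl⟩ := hx
    exact ⟨g * h, by simp [hmul, lTensor_counitOne]⟩
  | zero => exact ⟨0, by simp⟩
  | add x y _ _ hx hy =>
    obtain ⟨a, ha⟩ := hx
    obtain ⟨b, hb⟩ := hy
    exact ⟨a + b, by rw [map_add, ha, hb, TensorProduct.add_tmul]⟩
  | smul c x _ hx =>
    obtain ⟨a, ha⟩ := hx
    exact ⟨c • a, by rw [map_smul, ha, TensorProduct.smul_tmul']⟩

/-- A finite quantum group has a counit. -/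
theorem exists_counit [Nontrivial H] : ∃ ε : H →ₐ[ℂ] ℂ,
    (∀ a, TensorProduct.rid ℂ H (LinearMap.lTensor H ε.toLinearMap (Q.Δ a)) = a) ∧
    ∀ a, TensorProduct.lid ℂ H (LinearMap.rTensor H ε.toLinearMap (Q.Δ a)) = a := by
  -- Slicing with a functional that does not vanish at 1 allows a tensor leg equal to 1 to be
  -- cancelled.
  obtain ⟨f, hf⟩ := Module.Projective.exists_dual_ne_zero ℂ (one_ne_zero (α := H))
  have hinj : Function.Injective (algebraMap ℂ H) := (algebraMap ℂ H).injective
  have hscal : ∀ a, ∃ c : ℂ, Q.counitOne a = c • (1 : H) := by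
    intro a
    obtain ⟨h, hh⟩ := Q.lTensor_counitOne_mem (1 ⊗ₜ a)
    rw [LinearMap.lTensor_tmul] at hh
    have h1 : f 1 • Q.counitOne a = f h • (1 : H) := by
      simpa using congrArg (fun x => TensorProduct.lid ℂ H (LinearMap.rTensor H f x)) hh
    exact ⟨(f 1)⁻¹ * f h, by rw [mul_smul, ← h1, inv_smul_smul₀ hf]⟩
  let e : H →ₗ[ℂ] ℂ := (f 1)⁻¹ • (f ∘ₗ Q.counitOne)
  have he : ∀ a, Q.counitOne a = e a • (1 : H) := by
    intro a
    obtain ⟨c, hc⟩ := hscal a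
    rw [hc]
    congr 1
    simp [e, hc]
    field_simp
  have haux : ∀ x, Q.counitAux x = TensorProduct.lid ℂ H (LinearMap.rTensor H e x) := by
    intro x
    induction x with
    | zero => simp
    | add y z hy hz => simp only [map_add, hy, hz]
    | tmul c d => simp [counitAux_tmul, he]
  have hleft : ∀ a, TensorProduct.lid ℂ H (LinearMap.rTensor H e (Q.Δ a)) = a := by
    intro a
    rw [← haux]
    simpa [← Algebra.TensorProduct.one_def] using Q.counitAux_apply a 1
  have hright : ∀ a, TensorProduct.rid ℂ H (LinearMap.lTensor H e (Q.Δ a)) = a := by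
    intro a
    have h : ∀ y : H ⊗[ℂ] H, LinearMap.lTensor H Q.counitOne y =
        TensorProduct.rid ℂ H (LinearMap.lTensor H e y) ⊗ₜ 1 := by
      intro y
      induction y with
      | zero => simp
      | add y z hy hz => simp only [TensorProduct.add_tmul, map_add, hy, hz]
      | tmul c d => simp [he, TensorProduct.smul_tmul']
    have h2 := Q.lTensor_counitOne a
    rw [h] at h2
    have h3 := congrArg (fun x => TensorProduct.rid ℂ H (LinearMap.lTensor H f x)) h2
    simp only [LinearMap.lTensor_tmul, TensorProduct.rid_tmul] at h3
    exact smul_right_injective H hf h3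
  have hone : e 1 = 1 := by
    apply hinj
    have := hleft 1
    simpa [Algebra.TensorProduct.one_def, Algebra.algebraMap_eq_smul_one] using this
  -- Since `e ⊗ id` is left linear along `Δ`, it sends `Δ b * (y ⊗ c)` to `e y • (b * c)`. Right
  -- cancellation extends this to `x * (y ⊗ 1)` for all `x`, and `x = a ⊗ 1` gives multiplicativity.
  have hmul : ∀ a b, e (a * b) = e a * e b := by
    intro a y
    have h : ∀ x : H ⊗[ℂ] H, TensorProduct.lid ℂ H (LinearMap.rTensor H e (x * (y ⊗ₜ[ℂ] 1))) =
        e y • TensorProduct.lid ℂ H (LinearMap.rTensor H e x) := by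
      intro x
      refine Q.ext_right (f := (TensorProduct.lid ℂ H).toLinearMap ∘ₗ LinearMap.rTensor H e ∘ₗ
        LinearMap.mulRight ℂ (y ⊗ₜ[ℂ] 1)) (g := e y • ((TensorProduct.lid ℂ H).toLinearMap ∘ₗ
        LinearMap.rTensor H e)) (fun b c => ?_) x
      simp only [LinearMap.comp_apply, LinearMap.mulRight_apply, LinearMap.smul_apply,
        LinearEquiv.coe_coe, ← haux]
      rw [mul_assoc, counitAux_comul_mul, counitAux_comul_mul]
      simp [counitAux_tmul, he, hone]
    have h1 := h (a ⊗ₜ 1)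
    simp only [Algebra.TensorProduct.tmul_mul_tmul, LinearMap.rTensor_tmul, mul_one,
      TensorProduct.lid_tmul, smul_smul] at h1
    rw [mul_comm (e a)]
    exact hinj (by simpa only [Algebra.algebraMap_eq_smul_one] using h1)
  exact ⟨AlgHom.ofLinearMap e hone hmul, hright, hleft⟩

/-- A right colinear algebra endomorphism of a finite quantum group is injective. -/
theorem injective_of_colinear [Nontrivial H] (τ : H →ₐ[ℂ] H)
    (hτ : ∀ a, LinearMap.rTensor H τ.toLinearMap (Q.Δ a) = Q.Δ (τ a)) :
    Function.Injective τ := by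
  obtain ⟨ε, -, hε⟩ := Q.exists_counit
  -- Colinearity makes `τ` the convolution `(χ ⊗ id) ∘ Δ` with a character. As `χ ⊗ id` sends `(g ⊗
  -- 1) * Δ h` to `χ g • τ h`, left cancellation makes `τ` surjective, hence injective by dimension.
  let χ : H →ₐ[ℂ] ℂ := ε.comp τ
  have hχ : ∀ a, TensorProduct.lid ℂ H (LinearMap.rTensor H χ.toLinearMap (Q.Δ a)) = τ a := by
    intro a
    rw [← hε (τ a), ← hτ, ← LinearMap.comp_apply, ← LinearMap.rTensor_comp]
    rfl
  have hs : Function.Surjective τ.toLinearMap := by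
    rw [← LinearMap.range_eq_top, ← top_le_iff]
    intro b _
    have hb : b = TensorProduct.lid ℂ H (LinearMap.rTensor H χ.toLinearMap (1 ⊗ₜ b)) := by simp
    have hx : (1 : H) ⊗ₜ[ℂ] b ∈
        Submodule.span ℂ {x : H ⊗[ℂ] H | ∃ g h : H, x = (g ⊗ₜ[ℂ] 1) * Q.Δ h} := by
      rw [Q.span_left]; trivial
    have hle : Submodule.span ℂ {x : H ⊗[ℂ] H | ∃ g h : H, x = (g ⊗ₜ[ℂ] 1) * Q.Δ h} ≤
        (LinearMap.range τ.toLinearMap).comap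
          ((TensorProduct.lid ℂ H).toLinearMap ∘ₗ LinearMap.rTensor H χ.toLinearMap) := by
      rw [Submodule.span_le]
      rintro _ ⟨g, h, rfl⟩
      refine ⟨χ g • h, ?_⟩
      have hmul : ∀ y : H ⊗[ℂ] H, TensorProduct.lid ℂ H
          (LinearMap.rTensor H χ.toLinearMap ((g ⊗ₜ[ℂ] 1) * y)) =
          χ g • TensorProduct.lid ℂ H (LinearMap.rTensor H χ.toLinearMap y) := by
        intro y
        induction y with
        | zero => simp
        | add y z hy hz => simp only [mul_add, map_add, smul_add, hy, hz]
        | tmul c d => simp [smul_smul]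
      simp [hmul, hχ]
    rw [hb]
    exact hle hx
  exact LinearMap.injective_iff_surjective.2 hs

end QuantumGroup

/-! ### The path of endomorphisms attached to `φ`. -/

/-- The evaluation at a point of the interval, composed with `id ⊗ ε`. -/
def slicedEval {H : Type w} [CStarAlgebra H] [FiniteDimensional ℂ H] {Q : QuantumGroup H}
    (ε : H →ₐ[ℂ] ℂ) (φ : H →⋆ₐ[ℂ] equivariantJoin Q.selfAction) (t : unitInterval) :
    H →ₐ[ℂ] H :=
  ((Algebra.TensorProduct.rid ℂ ℂ H).toAlgHom.comp
    (Algebra.TensorProduct.map (AlgHom.id ℂ H) ε)).comp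
    (AlgHom.ofLinearMap (joinEval Q.selfAction t ∘ₗ φ.toAlgHom.toLinearMap)
      (by simp [joinEval]) (by simp [joinEval]))

section SlicedEval

variable {H : Type w} [CStarAlgebra H] [FiniteDimensional ℂ H] {Q : QuantumGroup H}
  (ε : H →ₐ[ℂ] ℂ) (φ : H →⋆ₐ[ℂ] equivariantJoin Q.selfAction)

theorem slicedEval_apply (t : unitInterval) (a : H) :
    slicedEval ε φ t a =
      TensorProduct.rid ℂ H (LinearMap.lTensor H ε.toLinearMap ((φ a).1 t)) := rfl

/-- An equivariant homomorphism is recovered from its slices. -/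
theorem rTensor_slicedEval (hφ : IsEquivariant Q.selfAction φ)
    (hε : ∀ a, TensorProduct.lid ℂ H (LinearMap.rTensor H ε.toLinearMap (Q.Δ a)) = a)
    (t : unitInterval) (a : H) :
    LinearMap.rTensor H (slicedEval ε φ t).toLinearMap (Q.Δ a) = (φ a).1 t := by
  have h1 := eval_joinCoaction Q.selfAction (φ a) t
  rw [← hφ a] at h1
  -- The map `id ⊗ ε ⊗ id` is applied to the equivariance identity at `t`: one side becomes
  -- `slicedEval ⊗ id`, and `h4` collapses the other by the left counit law.
  have h2 : ∀ y : H ⊗[ℂ] H, LinearMap.rTensor H (slicedEval ε φ t).toLinearMap y =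
      LinearMap.lTensor H ((TensorProduct.lid ℂ H).toLinearMap ∘ₗ
        LinearMap.rTensor H ε.toLinearMap) (TensorProduct.assoc ℂ H H H
        (LinearMap.rTensor H (joinEval Q.selfAction t)
          (LinearMap.rTensor H φ.toAlgHom.toLinearMap y))) := by
    intro y
    induction y with
    | zero => simp
    | add y z hy hz => simp only [map_add, hy, hz]
    | tmul c d =>
      have h3 : ∀ w : H ⊗[ℂ] H,
          (TensorProduct.rid ℂ H (LinearMap.lTensor H ε.toLinearMap w)) ⊗ₜ[ℂ] d =
          LinearMap.lTensor H ((TensorProduct.lid ℂ H).toLinearMap ∘ₗ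
            LinearMap.rTensor H ε.toLinearMap) (TensorProduct.assoc ℂ H H H (w ⊗ₜ d)) := by
        intro w
        induction w with
        | zero => simp
        | add y z hy hz => simp only [TensorProduct.add_tmul, map_add, hy, hz]
        | tmul p q => simp [TensorProduct.smul_tmul]
      exact h3 ((φ c).1 t)
  have h4 : ∀ y : H ⊗[ℂ] H, LinearMap.lTensor H ((TensorProduct.lid ℂ H).toLinearMap ∘ₗ
      LinearMap.rTensor H ε.toLinearMap) (LinearMap.lTensor H Q.Δ.toAlgHom.toLinearMap y) = y := by
    intro y
    rw [← LinearMap.comp_apply, ← LinearMap.lTensor_comp]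
    have hid : ((TensorProduct.lid ℂ H).toLinearMap ∘ₗ LinearMap.rTensor H ε.toLinearMap) ∘ₗ
        Q.Δ.toAlgHom.toLinearMap = LinearMap.id := LinearMap.ext hε
    rw [hid, LinearMap.lTensor_id, LinearMap.id_apply]
  rw [h2]
  exact (congrArg _ h1).trans (h4 _)

theorem slicedEval_zero (a : H) : ∃ c : ℂ, slicedEval ε φ 0 a = c • (1 : H) := by
  obtain ⟨h, hh⟩ := (φ a).2.1
  exact ⟨ε h, by rw [slicedEval_apply, hh]; simp⟩

/-- At `t = 1` the value is some `Δ b`, and the right counit law identifies `b` with the slice. With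
`rTensor_slicedEval` this yields colinearity at `t = 1`. -/
theorem comul_slicedEval_one
    (hε : ∀ a, TensorProduct.rid ℂ H (LinearMap.lTensor H ε.toLinearMap (Q.Δ a)) = a) (a : H) :
    Q.Δ (slicedEval ε φ 1 a) = (φ a).1 1 := by
  obtain ⟨b, hb⟩ := (φ a).2.2
  replace hb : (φ a).1 1 = Q.Δ b := hb
  rw [slicedEval_apply, hb, hε]

theorem continuous_trace_slicedEval (a : H) :
    Continuous fun t => LinearMap.trace ℂ H (LinearMap.mulLeft ℂ (slicedEval ε φ t a)) := by
  have h := IsModuleTopology.continuous_of_linearMap (R := ℂ) (A := H ⊗[ℂ] H) (B := ℂ)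
    (LinearMap.trace ℂ H ∘ₗ LinearMap.mul ℂ H ∘ₗ (TensorProduct.rid ℂ H).toLinearMap ∘ₗ
      LinearMap.lTensor H ε.toLinearMap)
  exact h.comp (φ a).1.continuous

end SlicedEval

/-! ### The contradiction. -/

/-- A finite quantum group other than the trivial one admits no equivariant unital
⋆-homomorphism from its algebra to its equivariant join. -/
theorem not_exists_isEquivariant {H : Type w} [CStarAlgebra H] [FiniteDimensional ℂ H]
    (Q : QuantumGroup H) (hH : ¬ Function.Surjective (algebraMap ℂ H)) :
    ¬ ∃ φ : H →⋆ₐ[ℂ] equivariantJoin Q.selfAction, IsEquivariant Q.selfAction φ := by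
  rintro ⟨φ, hφ⟩
  obtain ⟨p, hp, hp0, hp1⟩ := exists_nontrivial_idempotent hH
  have : Nontrivial H := ⟨p, 0, hp0⟩
  obtain ⟨ε, hr, hl⟩ := Q.exists_counit
  have hinj : Function.Injective (slicedEval ε φ 1) :=
    Q.injective_of_colinear _ fun a => by
      rw [rTensor_slicedEval ε φ hφ hl, comul_slicedEval_one ε φ hr]
  have key : ∀ q : H, IsIdempotentElem q → slicedEval ε φ 0 q = 0 → q = 0 := by
    intro q hq h0
    have hidem : ∀ t, IsIdempotentElem (LinearMap.mulLeft ℂ (slicedEval ε φ t q)) := fun t => by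
      rw [IsIdempotentElem, Module.End.mul_eq_comp, ← LinearMap.mulLeft_mul, ← map_mul, hq.eq]
    -- The trace vanishes at 0, hence at 1, and an idempotent of trace zero is zero.
    have htr := trace_constant_of_idempotents _ hidem (continuous_trace_slicedEval ε φ q) 1 0
    rw [h0, LinearMap.mulLeft_zero_eq_zero, map_zero,
      LinearMap.IsIdempotentElem.trace_eq_zero_iff (hidem 1), LinearMap.mulLeft_eq_zero_iff] at htr
    exact hinj (htr.trans (map_zero _).symm)
  obtain ⟨c, hc⟩ := slicedEval_zero ε φ p
  -- The endomorphism at 0 preserves idempotents, so the scalar `c` is 0 or 1; in the latter case `1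
  -- - p` replaces `p`.
  have hcc : c * c = c := by
    have h := congrArg (slicedEval ε φ 0) hp.eq
    rw [map_mul, hc, smul_mul_smul_comm, mul_one] at h
    exact smul_left_injective ℂ (one_ne_zero (α := H)) h
  rcases IsIdempotentElem.iff_eq_zero_or_one.1 hcc with rfl | rfl
  · exact hp0 (key p hp (by rw [hc, zero_smul]))
  · refine hp1 (sub_eq_zero.1 (key (1 - p) hp.one_sub ?_)).symm
    rw [map_sub, map_one, hc, one_smul, sub_self]

end FiniteQuantum

end

theorem theorem2p9 {H : Type*} [CStarAlgebra H] [FiniteDimensional ℂ H]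
    (Q : FiniteQuantum.QuantumGroup H)
    (hnontriv : ¬ Function.Surjective (algebraMap ℂ H)) :
    ¬ ∃ φ : H →⋆ₐ[ℂ] FiniteQuantum.equivariantJoin Q.selfAction,
      FiniteQuantum.IsEquivariant Q.selfAction φ :=
  FiniteQuantum.not_exists_isEquivariant Q hnontriv
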